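/- Let $G$ be a group that is not virtually cyclic, with a finite generating set $S$; let $d_S(g,h)$ be the least $n$ such that $h=gs_1\cdots s_n$ with $s_i\in S\cup S^{-1}$, and let $\|g\|_S=d_S(\mathrm{id},g)$. Let $G$ act by isometries on a geodesic metric space $(X,d_X)$ which is $\delta$-hyperbolic for some $\delta>0$ (each side of every geodesic triangle lies in the closed $\delta$-neighbourhood of the union of the other two sides). Let $f\in G$ be a unital axial WPD loxodromic element, that is: there is an isometric embedding $\gamma:\mathbb R\to X$ with $f\gamma(t)=\gamma(t+1)$ for all $t$, and, writing $Ax(f)=\gamma(\mathbb R)$ and fixing $x_0\in Ax(f)$, for every $R>0$ there is an integer $L>0$ such that $$\{g\in G: d_X(x_0,gx_0)<R \text{ and } d_X(f^Lx_0,gf^Lx_0)<R\}$$ is finite. For a translate $A=hAx(f)$, $h\in G$, and $x,y\in X$, let $d_A(x,y)$ be the diameter of the set of all points of $A$ that are nearest in $A$ to $x$ or nearest in $A$ to $y$. For $D,E>0$ put $$\mathcal{NF}_D=\{g\in G: d_{hAx(f)}(x_0,gx_0)<D\ \text{for all } h\in G\},\qquad \mathcal{NF}_D^{\ge E}=\{g\in\mathcal{NF}_D:\|g\|_S\ge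 E\}.$$ Then there are $D_0,E_0>0$ such that for all real $D\ge D_0$ and $E\ge E_0$ there exists $E'>0$ with the following property. Let $g\in G$ satisfy 1. there is no $h\in G$ with $\|h\|_S\le E'$ and $d_{hAx(f)}(x_0,gx_0)\ge 250D$; 2. $\|g\|_S\ge E$. Then for every $d_S$-path $(\mathrm{id}=g_0,g_1,\dots,g_N=g)$, i.e. every finite sequence with $d_S(g_i,g_{i+1})\le 1$ for $0\le i<N$, there is $t\in\{0,\dots,N\}$ with $g_t\in\mathcal{NF}_{300D}^{\ge E}$. -/

import Mathlib

namespace WPDBarrier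

/-! ### Word metric -/

section Word

variable {G : Type*} [Group G]

/-- The word metric `d_S(g, h)`: the least `n` such that `h = g s₁ ⋯ sₙ` with all
`sᵢ ∈ S ∪ S⁻¹`. (The set is non-empty as soon as `S` generates `G`.) -/
noncomputable def wordDist (S : Set G) (g h : G) : ℕ :=
  sInf {n : ℕ | ∃ l : List G, l.length = n ∧ (∀ s ∈ l, s ∈ S ∨ s⁻¹ ∈ S) ∧ h = g * l.prod}

/-- The word norm `‖g‖_S = d_S(id, g)`. -/
noncomputable def wordNorm (S : Set G) (g : G) : ℕ := wordDist S 1 g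

/-- `(p 0, p 1, …, p N)` is a `d_S`-path from `a` to `b`: consecutive terms are at word distance
at most one. -/
def IsWordPath (S : Set G) (a b : G) (N : ℕ) (p : ℕ → G) : Prop :=
  p 0 = a ∧ p N = b ∧ ∀ i < N, wordDist S (p i) (p (i + 1)) ≤ 1

/-- `G` is virtually cyclic: it has a cyclic subgroup of finite index. -/
def VirtuallyCyclic (G : Type*) [Group G] : Prop :=
  ∃ H : Subgroup G, IsCyclic H ∧ H.FiniteIndex

end Word

/-! ### Geodesics, hyperbolicity, nearest point projections -/

section Metric

variable {X : Type*} [MetricSpace X]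

/-- The subset `s` is (the image of) a geodesic segment from `x` to `y`. -/
def IsGeodesicSegment (x y : X) (s : Set X) : Prop :=
  ∃ c : ℝ → X, c 0 = x ∧ c (dist x y) = y ∧
    (∀ t ∈ Set.Icc 0 (dist x y), ∀ t' ∈ Set.Icc 0 (dist x y), dist (c t) (c t') = |t - t'|) ∧
    s = c '' Set.Icc 0 (dist x y)

/-- Every two points are joined by a geodesic segment. -/
def IsGeodesicSpace (X : Type*) [MetricSpace X] : Prop :=
  ∀ x y : X, ∃ s : Set X, IsGeodesicSegment x y s

/-- `δ`-hyperbolicity (Rips): each side of every geodesic triangle lies in the (closed)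
`δ`-neighbourhood of the union of the two other sides. -/
def IsHyperbolicSpace (X : Type*) [MetricSpace X] (δ : ℝ) : Prop :=
  ∀ (x y z : X) (a b c : Set X), IsGeodesicSegment x y a → IsGeodesicSegment y z b →
    IsGeodesicSegment x z c → ∀ p ∈ c, ∃ q ∈ a ∪ b, dist q p ≤ δ

/-- The nearest point projection `π_A(B)` of a set `B` to a set `A`: all points of `A` that
realise the distance to `A` of some point of `B`. -/
def nearestProj (A B : Set X) : Set X :=
  {a | a ∈ A ∧ ∃ b ∈ B, ∀ y ∈ A, dist b a ≤ dist b y}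

/-- The projection distance `d_A(x, y) = diam π_A({x, y})`. -/
noncomputable def projDist (A : Set X) (x y : X) : ℝ :=
  Metric.diam (nearestProj A {x, y})

end Metric

/-! ### Unital axial WPD loxodromics -/

section Action

variable {G : Type*} [Group G] {X : Type*} [MetricSpace X] [MulAction G X]

/-- `γ : ℝ → X` is a (bi-infinite geodesic) axis of `f`, along which `f` translates by exactly
one: `f` is unital axial loxodromic with axis `γ`. -/
def IsUnitalAxis (f : G) (γ : ℝ → X) : Prop :=
  Isometry γ ∧ ∀ t : ℝ, f • γ t = γ (t + 1)

/-- `f` is loxodromic, with respect to the base point `x₀`. -/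
def IsLoxodromic (f : G) (x₀ : X) : Prop :=
  ∃ τ : ℝ, 0 < τ ∧ ∀ n : ℕ, τ * n ≤ dist x₀ (f ^ n • x₀)

/-- `f` is a loxodromic with the WPD (weak proper discontinuity) property, with respect to the
base point `x₀`. -/
def IsWPDLoxodromic (f : G) (x₀ : X) : Prop :=
  IsLoxodromic f x₀ ∧ ∀ R : ℝ, 0 < R → ∃ L : ℕ, 0 < L ∧
    {g : G | dist x₀ (g • x₀) < R ∧ dist (f ^ L • x₀) (g • f ^ L • x₀) < R}.Finite

/-- The translate `gA` of a subset `A` of `X`. -/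
def translate (g : G) (A : Set X) : Set X := (fun x => g • x) '' A

/-- The set `NF_D` of those `g` such that every translate `γ` of the axis `A` satisfies
`d_γ(x₀, g x₀) < D`. -/
def NF (G : Type*) [Group G] [MulAction G X] (A : Set X) (x₀ : X) (D : ℝ) : Set G :=
  {g | ∀ h : G, projDist (translate h A) x₀ (g • x₀) < D}

/-- The set `NF_D^{≥ E}` of the elements of `NF_D` of word norm at least `E`. -/
def NFge (S : Set G) (A : Set X) (x₀ : X) (D E : ℝ) : Set G :=
  {g | g ∈ NF G A x₀ D ∧ E ≤ (wordNorm S g : ℝ)}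

end Action

end WPDBarrier

/-!
A path from the identity to `g` is followed through its orbit points, and one looks at how far it
has progressed along each translate of the axis `A` of `f`, measured by nearest point projection.

*Geometry.* All that is used about hyperbolicity is that a geodesic line is strongly contracting
(`isContracting_range`): if two points have far apart projections to the line, then a geodesic
between them is, up to a constant, as long as the broken line through the projections. It implies
that two lines with a large mutual projection fellow travel (`exists_near_of_dist_proj`) and that
two lines with bounded mutual projections satisfy Behrstock's inequality
(`dist_proj_le_or_dist_proj_le`). The WPD property enters through
`exists_bound_proj_or_isParallel`: two translates of `A` are either parallel, at a uniformly
bounded Hausdorff distance, or have uniformly bounded projections to each other. So the translates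
of `A` form an `AxisSystem`, in which the axes with a large projection distance between `x₀` and a
given point `y` are linearly ordered, up to parallelism, by their distance from `x₀`; in particular
there are only finitely many of them.

*Combinatorics.* If `g` itself has a large projection, let `A` be the first axis along which `g x₀`
is at least `260D` away, and stop the path when it crosses `100D` along `A`
(`exists_controls_self`). If at this time there is a projection of size `299D`, it lies on an axis
after `A`; take the first such axis `B`, and wait until the path leaves `B`, as it must in order to
reach `g x₀`. Repeating this, one gets a strictly increasing sequence of times
(`Controls.exists_gt`), which has to end, at a time without large projections
(`exists_time_forall_size_lt`). The delicate point is that the position along `A` must not drift in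
this process. Therefore `Controls` records a property of all times at which the path has the same
`B`-coordinate as at the current time: it passes from one axis to the next without any loss in the
constants.

Finally, at that time the path is still far along `A`. Elements of word norm less than `E` see, up
to parallelism, only finitely many axes (`exists_wordNorm_bound`), and by the assumption on `g` the
axis `A` is not among them if `E'` is large; so the element found has norm at least `E`.
-/

namespace WPDBarrier

/-! ### Nearest points on geodesic lines of a hyperbolic space -/

section Geometry

variable {X : Type*} [MetricSpace X]

/-- `p` is a point of `A` that realises the distance from `x` to `A`. -/
def IsNearest (A : Set X) (x p : X) : Prop :=
  p ∈ A ∧ ∀ y ∈ A, dist x p ≤ dist x y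

/-- The strong contraction property with constant `K`: if `x` and `y` have nearest points `p`, `q`
in `A` that are more than `K` apart, then the broken line `x, p, q, y` is, up to `K`, as short as
possible. -/
def IsContracting (A : Set X) (K : ℝ) : Prop :=
  ∀ x y p q : X, IsNearest A x p → IsNearest A y q →
    dist p q ≤ K ∨ dist x p + dist p q + dist q y ≤ dist x y + K

/-- Each of `A` and `B` lies in the closed `c`-neighbourhood of the other one, with the distance
bound attained. -/
def IsParallel (c : ℝ) (A B : Set X) : Prop :=
  (∀ a ∈ A, ∃ b ∈ B, dist a b ≤ c) ∧ ∀ b ∈ B, ∃ a ∈ A, dist b a ≤ c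

theorem IsParallel.symm {c : ℝ} {A B : Set X} (h : IsParallel c A B) : IsParallel c B A :=
  ⟨h.2, h.1⟩

theorem isNearest_self {A : Set X} {a : X} (ha : a ∈ A) : IsNearest A a a :=
  ⟨ha, fun y _ => by simp⟩

theorem nearestProj_pair (A : Set X) (x y : X) :
    nearestProj A {x, y} = {a | IsNearest A x a ∨ IsNearest A y a} := by
  ext a
  simp only [nearestProj, IsNearest, Set.mem_ofPred_eq, Set.mem_insert_iff, Set.mem_singleton_iff]
  constructor
  · rintro ⟨ha, b, rfl | rfl, hb⟩
    · exact Or.inl ⟨ha, hb⟩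
    · exact Or.inr ⟨ha, hb⟩
  · rintro (⟨ha, hb⟩ | ⟨ha, hb⟩)
    · exact ⟨ha, x, Or.inl rfl, hb⟩
    · exact ⟨ha, y, Or.inr rfl, hb⟩

theorem exists_isNearest {γ : ℝ → X} (hγ : Isometry γ) (x : X) :
    ∃ p, IsNearest (Set.range γ) x p := by
  have hcont : Continuous fun t => dist x (γ t) := continuous_const.dist hγ.continuous
  have hlim : Filter.Tendsto (fun t => dist x (γ t)) (Filter.cocompact ℝ) Filter.atTop := by
    have h0 : Filter.Tendsto (fun t : ℝ => dist t 0) (Filter.cocompact ℝ) Filter.atTop :=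
      tendsto_dist_right_cocompact_atTop 0
    refine Filter.tendsto_atTop_mono (fun t => ?_)
      (Filter.tendsto_atTop_add_const_right _ (-dist x (γ 0)) h0)
    have := dist_triangle_left (γ t) (γ 0) x
    rw [hγ.dist_eq] at this
    linarith
  obtain ⟨t, ht⟩ := hcont.exists_forall_le hlim
  exact ⟨γ t, ⟨t, rfl⟩, by rintro _ ⟨s, rfl⟩; exact ht s⟩

theorem IsGeodesicSegment.dist_add_dist {x y z : X} {s : Set X} (hs : IsGeodesicSegment x y s)
    (hz : z ∈ s) : dist x z + dist z y = dist x y := by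
  obtain ⟨c, h0, h1, hc, rfl⟩ := hs
  obtain ⟨t, ht, rfl⟩ := hz
  have h2 := hc 0 ⟨le_rfl, dist_nonneg⟩ t ht
  have h3 := hc t ht (dist x y) ⟨dist_nonneg, le_rfl⟩
  rw [h0, zero_sub, abs_neg, abs_of_nonneg ht.1] at h2
  rw [h1, abs_sub_comm, abs_of_nonneg (sub_nonneg.2 ht.2)] at h3
  linarith

/-- Between two points of a line there is a geodesic segment contained in the line, and it has a
point at each admissible distance `r` from its origin. -/
theorem exists_segment_of_isometry {γ : ℝ → X} (hγ : Isometry γ) {p q : X}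
    (hp : p ∈ Set.range γ) (hq : q ∈ Set.range γ) :
    ∃ s : Set X, IsGeodesicSegment p q s ∧ s ⊆ Set.range γ ∧
      ∀ r, 0 ≤ r → r ≤ dist p q → ∃ m ∈ s, dist p m = r := by
  obtain ⟨a, rfl⟩ := hp
  obtain ⟨b, rfl⟩ := hq
  obtain ⟨σ, hσ, hb⟩ : ∃ σ : ℝ, |σ| = 1 ∧ b = a + σ * dist (γ a) (γ b) := by
    rw [hγ.dist_eq, Real.dist_eq]
    rcases le_total a b with h | h
    · exact ⟨1, by simp, by rw [abs_sub_comm, abs_of_nonneg (sub_nonneg.2 h)]; ring⟩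
    · exact ⟨-1, by simp, by rw [abs_of_nonneg (sub_nonneg.2 h)]; ring⟩
  have hd : ∀ t t' : ℝ, dist (γ (a + σ * t)) (γ (a + σ * t')) = |t - t'| := fun t t' => by
    rw [hγ.dist_eq, Real.dist_eq, add_sub_add_left_eq_sub, ← mul_sub, abs_mul, hσ, one_mul]
  refine ⟨(fun t => γ (a + σ * t)) '' Set.Icc 0 (dist (γ a) (γ b)),
    ⟨fun t => γ (a + σ * t), by simp, ?_, fun t _ t' _ => hd t t', rfl⟩, ?_, fun r h0 h1 => ?_⟩
  · change γ _ = _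
    rw [← hb]
  · rintro _ ⟨t, -, rfl⟩
    exact ⟨_, rfl⟩
  · refine ⟨_, ⟨r, ⟨h0, h1⟩, rfl⟩, ?_⟩
    have := hd 0 r
    simpa [abs_of_nonneg h0] using this

/-- A point `w` close to a geodesic from `x` to its nearest point `p` and to a point `m` of `A`
shows that `m` is close to `p`. -/
theorem IsNearest.dist_le_of_near_segment {A : Set X} {x p m w : X} {r : ℝ} (hp : IsNearest A x p)
    (hm : m ∈ A) (hw : dist x w + dist w p = dist x p) (hwm : dist w m ≤ r) :
    dist p m ≤ 2 * r := by
  have h1 := hp.2 m hm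
  have h2 := dist_triangle x w m
  have h3 := dist_triangle_left p m w
  linarith

section Hyperbolic

variable {δ : ℝ} {γ : ℝ → X}

theorem IsNearest.dist_add_dist_le_of_hyperbolic (hgeo : IsGeodesicSpace X) (hδ : 0 < δ)
    (hhyp : IsHyperbolicSpace X δ) (hγ : Isometry γ) {x p a : X}
    (hp : IsNearest (Set.range γ) x p) (ha : a ∈ Set.range γ) :
    dist x p + dist p a ≤ dist x a + 8 * δ := by
  by_cases hpa : dist p a ≤ 3 * δ
  · linarith [hp.2 a ha]
  push Not at hpa
  obtain ⟨s, hs, hsA, hsr⟩ := exists_segment_of_isometry hγ hp.1 ha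
  obtain ⟨m, hms, hpm⟩ := hsr (3 * δ) (by positivity) hpa.le
  obtain ⟨s₁, hs₁⟩ := hgeo p x
  obtain ⟨s₂, hs₂⟩ := hgeo x a
  obtain ⟨w, hw | hw, hwm⟩ := hhyp p x a s₁ s₂ s hs₁ hs₂ hs m hms
  · have h := hs₁.dist_add_dist hw
    have := hp.dist_le_of_near_segment (hsA hms)
      (by rw [dist_comm x w, dist_comm w p, dist_comm x p]; linarith) hwm
    linarith
  · have h1 := hs₂.dist_add_dist hw
    have h2 := hs.dist_add_dist hms
    have h3 := hp.2 m (hsA hms)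
    have h4 := dist_triangle x w m
    have h5 := dist_triangle_left m a w
    linarith

/-- Lines in a hyperbolic space are strongly contracting. -/
theorem isContracting_range (hgeo : IsGeodesicSpace X) (hδ : 0 < δ)
    (hhyp : IsHyperbolicSpace X δ) (hγ : Isometry γ) :
    IsContracting (Set.range γ) (22 * δ) := by
  intro x y p q hp hq
  by_cases hpq : dist p q ≤ 22 * δ
  · exact Or.inl hpq
  right
  push Not at hpq
  obtain ⟨s, hs, hsA, hsr⟩ := exists_segment_of_isometry hγ hp.1 hq.1
  -- `m` is too far from `p` and from `q` to be near the sides `[x, p]` and `[y, q]` of the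
  -- quadrilateral `x, p, q, y`, so it is near the side `[x, y]`.
  obtain ⟨m, hms, hpm⟩ := hsr (5 * δ) (by positivity) (by linarith)
  have hpmq := hs.dist_add_dist hms
  obtain ⟨s₁, hs₁⟩ := hgeo p x
  obtain ⟨s₂, hs₂⟩ := hgeo x q
  obtain ⟨s₃, hs₃⟩ := hgeo x y
  obtain ⟨s₄, hs₄⟩ := hgeo y q
  obtain ⟨w, hw | hw, hwm⟩ := hhyp p x q s₁ s₂ s hs₁ hs₂ hs m hms
  · have h := hs₁.dist_add_dist hw
    have := hp.dist_le_of_near_segment (hsA hms)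
      (by rw [dist_comm x w, dist_comm w p, dist_comm x p]; linarith) hwm
    linarith
  obtain ⟨v, hv | hv, hvw⟩ := hhyp x y q s₃ s₄ s₂ hs₃ hs₄ hs₂ w hw
  · have h1 := hs₃.dist_add_dist hv
    have h2 := hp.2 m (hsA hms)
    have h3 := hq.dist_add_dist_le_of_hyperbolic hgeo hδ hhyp hγ (hsA hms)
    have h4 := dist_triangle x v m
    have h5 := dist_triangle y v m
    have h6 := dist_triangle v w m
    rw [dist_comm y v] at h5
    rw [dist_comm q m] at h3
    rw [dist_comm q y]
    linarith
  · have h := hs₄.dist_add_dist hv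
    have h6 := dist_triangle v w m
    have h7 := hq.dist_le_of_near_segment (r := 2 * δ) (hsA hms) h (by linarith)
    rw [dist_comm] at h7
    linarith

end Hyperbolic

/-! ### Consequences of strong contraction -/

section Contracting

variable {A B : Set X} {K : ℝ}

theorem IsContracting.dist_add_dist_le (hA : IsContracting A K) {x p a : X}
    (hp : IsNearest A x p) (ha : a ∈ A) : dist x p + dist p a ≤ dist x a + K := by
  rcases hA x a p a hp (isNearest_self ha) with h | h
  · linarith [hp.2 a ha]
  · simpa using h

theorem IsContracting.dist_proj_le (hA : IsContracting A K) {x y p q : X}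
    (hp : IsNearest A x p) (hq : IsNearest A y q) : dist p q ≤ dist x y + K := by
  rcases hA x y p q hp hq with h | h
  · linarith [dist_nonneg (x := x) (y := y)]
  · linarith [dist_nonneg (x := x) (y := p), dist_nonneg (x := q) (y := y)]

theorem IsContracting.dist_le_of_isNearest (hA : IsContracting A K) {x p q : X}
    (hp : IsNearest A x p) (hq : IsNearest A x q) : dist p q ≤ K := by
  simpa using hA.dist_proj_le hp hq

/-- The diameter `projDist` differs by at most `2 * K` from the distance of any two nearest
points. -/
theorem IsContracting.le_projDist_and_projDist_le (hA : IsContracting A K) (hK : 0 ≤ K)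
    {x y p q : X} (hp : IsNearest A x p) (hq : IsNearest A y q) :
    dist p q ≤ projDist A x y ∧ projDist A x y ≤ dist p q + 2 * K := by
  have hle : ∀ a ∈ nearestProj A {x, y}, ∀ b ∈ nearestProj A {x, y},
      dist a b ≤ dist p q + 2 * K := by
    rw [nearestProj_pair]
    have key : ∀ a b, IsNearest A x a → IsNearest A y b → dist a b ≤ dist p q + 2 * K := by
      intro a b ha hb
      have h1 := hA.dist_le_of_isNearest ha hp
      have h2 := hA.dist_le_of_isNearest hq hb
      have h3 := dist_triangle4 a p q b
      linarith
    have h0 : 0 ≤ dist p q := dist_nonneg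
    rintro a (ha | ha) b (hb | hb)
    · linarith [hA.dist_le_of_isNearest ha hb]
    · exact key a b ha hb
    · rw [dist_comm]; exact key b a hb ha
    · linarith [hA.dist_le_of_isNearest ha hb]
  refine ⟨?_, Metric.diam_le_of_forall_dist_le (by positivity) hle⟩
  refine Metric.dist_le_diam_of_mem (Metric.isBounded_iff.2 ⟨_, fun a ha b hb => hle a ha b hb⟩)
    ?_ ?_ <;> rw [nearestProj_pair]
  exacts [Or.inl hp, Or.inr hq]

/-- If two points of `B` have far apart projections `p₁`, `p₂` to `A`, then the part of `A`
between `p₁` and `p₂` runs close to `B`. -/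
theorem exists_near_of_dist_proj (hA : IsContracting A K) (hB : IsContracting B K) (hK : 0 ≤ K)
    (hBn : ∀ x, ∃ p, IsNearest B x p) {b₁ b₂ p₁ p₂ p : X} (hb₁ : b₁ ∈ B) (hb₂ : b₂ ∈ B)
    (h₁ : IsNearest A b₁ p₁) (h₂ : IsNearest A b₂ p₂) (hlong : 6 * K < dist p₁ p₂)
    (hp : dist p₁ p + dist p p₂ = dist p₁ p₂) : ∃ q ∈ B, dist p q ≤ 6 * K := by
  obtain ⟨q₁, hq₁⟩ := hBn p₁
  obtain ⟨q₂, hq₂⟩ := hBn p₂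
  obtain ⟨q, hq⟩ := hBn p
  refine ⟨q, hq.1, ?_⟩
  -- The broken line `b₁, p₁, p₂, b₂` is nearly geodesic, whereas the path through the projections
  -- `q₁`, `q₂` of `p₁`, `p₂` to `B` would be shorter if `p₁`, `p₂` were far from `B`; contraction
  -- of `B` applied to `p₁, p` and `p, p₂` then bounds `dist p q`.
  have e₁ : dist b₁ p₁ + dist p₁ p₂ + dist p₂ b₂ ≤ dist b₁ b₂ + K :=
    (hA _ _ _ _ h₁ h₂).resolve_left (by linarith)
  have e₂ := hB.dist_add_dist_le hq₁ hb₁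
  have e₃ := hB.dist_add_dist_le hq₂ hb₂
  have e₄ := dist_triangle4 b₁ q₁ q₂ b₂
  have n₁ : 0 ≤ dist p₁ q₁ := dist_nonneg
  have n₂ : 0 ≤ dist p₂ q₂ := dist_nonneg
  have n : 0 ≤ dist p q := dist_nonneg
  have t₁ := dist_triangle q₁ q q₂
  rw [dist_comm p₁ b₁, dist_comm q₁ b₁] at e₂
  have f₁ := hB _ _ _ _ hq₁ hq
  have f₂ := hB _ _ _ _ hq hq₂
  rw [dist_comm q p] at f₁
  rw [dist_comm q₂ p₂] at f₂
  rcases f₁ with f₁ | f₁ <;> rcases f₂ with f₂ | f₂ <;>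
    linarith [dist_nonneg (x := p) (y := p₂), dist_nonneg (x := p₁) (y := p)]

/-- Projections to two sets at finite Hausdorff distance agree up to a bounded error. -/
theorem IsParallel.dist_proj_le {c : ℝ} (hAB : IsParallel c A B) (hB : IsContracting B K)
    {x p q : X} (hp : IsNearest A x p) (hq : IsNearest B x q) :
    dist p q ≤ 3 * c + K := by
  obtain ⟨p', hp', hpp'⟩ := hAB.1 p hp.1
  obtain ⟨q', hq', hqq'⟩ := hAB.2 q hq.1
  have h1 := hB.dist_add_dist_le hq hp'
  have h2 := hp.2 q' hq'
  have h3 := dist_triangle x p p'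
  have h4 := dist_triangle x q q'
  have h5 := dist_triangle_right p q p'
  linarith

/-- Behrstock's inequality: if `x` and the set `B` project to far apart places of `A`, then `x` and
the set `A` project to the same place of `B`. Here `M` bounds the diameters of the projections of
`A` and `B` to each other. -/
theorem dist_proj_le_or_dist_proj_le {M : ℝ} (hA : IsContracting A K) (hB : IsContracting B K)
    (hK : 0 ≤ K) {a b x p q b' a' : X} (ha : a ∈ A) (hb : b ∈ B)
    (hp : IsNearest A x p) (hq : IsNearest B x q) (hb' : IsNearest A b b') (ha' : IsNearest B a a')
    (hAn : ∀ x, ∃ p, IsNearest A x p) (hBn : ∀ x, ∃ p, IsNearest B x p)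
    (hAB : ∀ b₁ ∈ B, ∀ b₂ ∈ B, ∀ p₁ p₂, IsNearest A b₁ p₁ → IsNearest A b₂ p₂ → dist p₁ p₂ ≤ M)
    (hBA : ∀ a₁ ∈ A, ∀ a₂ ∈ A, ∀ p₁ p₂, IsNearest B a₁ p₁ → IsNearest B a₂ p₂ → dist p₁ p₂ ≤ M) :
    dist p b' ≤ M + 2 * K ∨ dist q a' ≤ M + 2 * K := by
  obtain ⟨r, hr⟩ := hAn q
  obtain ⟨s, hs⟩ := hBn p
  rcases hA x q p r hp hr with h | h
  · left
    have h1 := hAB q hq.1 b hb r b' hr hb'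
    have h2 := dist_triangle p r b'
    linarith
  · right
    have h1 := hBA p hp.1 a ha s a' hs ha'
    have h2 := dist_triangle_left q a' s
    have h3 := hB.dist_add_dist_le hs hq.1
    have h4 := hq.2 s hs.1
    have h5 := dist_triangle x p s
    have h6 := dist_triangle p r q
    linarith

end Contracting

end Geometry

/-! ### Fellow travelling translates of the axis of a WPD element -/

section WPD

/-- A coarse isometric embedding of an interval of the real line into the real line is, up to a
bounded error, a translation or a reflection. -/
theorem exists_sign_of_coarse_isometry {s : ℝ → ℝ} {a b c : ℝ} (hab : c < b - a)
    (hs : ∀ t ∈ Set.Icc a b, ∀ u ∈ Set.Icc a b, |(|s t - s u| - |t - u|)| ≤ c) :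
    ∃ ε : ℤ, |ε| = 1 ∧
      ∀ t ∈ Set.Icc a b, ∀ u ∈ Set.Icc a b, |s u - s t - ε * (u - t)| ≤ 3 * c := by
  have hc : 0 ≤ c ∨ b < a := by
    by_contra! h
    linarith [hs a ⟨le_rfl, h.2⟩ a ⟨le_rfl, h.2⟩, abs_nonneg (|s a - s a| - |a - a|)]
  rcases hc with hc | hc
  swap
  · exact ⟨1, by simp, fun t ht => absurd (ht.1.trans ht.2) (not_le.2 hc)⟩
  have hab' : a ≤ b := by linarith
  have key : ∀ r : ℝ → ℝ,
      (∀ t ∈ Set.Icc a b, ∀ u ∈ Set.Icc a b, |(|r t - r u| - |t - u|)| ≤ c) → r a ≤ r b →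
      ∀ t ∈ Set.Icc a b, ∀ u ∈ Set.Icc a b, |r u - r t - (u - t)| ≤ 3 * c := by
    intro r hr h
    have hpt : ∀ t ∈ Set.Icc a b, t - a - 2 * c ≤ r t - r a ∧ r t - r a ≤ t - a + c := by
      intro t ht
      have h1 := hr a ⟨le_rfl, hab'⟩ b ⟨hab', le_rfl⟩
      have h2 := hr a ⟨le_rfl, hab'⟩ t ht
      have h3 := hr t ht b ⟨hab', le_rfl⟩
      rw [abs_sub_comm (r a), abs_of_nonneg (sub_nonneg.2 h), abs_sub_comm a,
        abs_of_nonneg (sub_nonneg.2 hab'), abs_le] at h1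
      rw [abs_sub_comm (r a), abs_sub_comm a, abs_of_nonneg (sub_nonneg.2 ht.1), abs_le] at h2
      rw [abs_sub_comm (r t), abs_sub_comm t, abs_of_nonneg (sub_nonneg.2 ht.2), abs_le] at h3
      constructor <;> linarith [le_abs_self (r t - r a), le_abs_self (r b - r t)]
    intro t ht u hu
    have h1 := hpt t ht
    have h2 := hpt u hu
    rw [abs_le]
    constructor <;> linarith
  rcases le_total (s a) (s b) with h | h
  · exact ⟨1, by simp, fun t ht u hu => by simpa using key s hs h t ht u hu⟩
  · refine ⟨-1, by simp, fun t ht u hu => ?_⟩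
    have := key (fun t => -s t)
      (fun t ht u hu => by
        have := hs t ht u hu
        rwa [neg_sub_neg, abs_sub_comm (s u)]) (by simpa using h) t ht u hu
    rw [← abs_neg]
    convert this using 2
    push_cast
    ring

section Action

variable {G : Type*} [Group G] {X : Type*} [MulAction G X]

theorem translate_range (h : G) (γ : ℝ → X) :
    translate h (Set.range γ) = Set.range fun t => h • γ t := by
  rw [translate, ← Set.range_comp]
  rfl

theorem zpow_smul_line {f : G} {γ : ℝ → X} (hγ : ∀ t, f • γ t = γ (t + 1)) (n : ℤ) (t : ℝ) :
    f ^ n • γ t = γ (t + n) := by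
  induction n using Int.induction_on generalizing t with
  | zero => simp
  | succ n ih =>
    rw [zpow_add_one, mul_smul, hγ, ih]
    congr 1
    push_cast
    ring
  | pred n ih =>
    have h : f⁻¹ • γ t = γ (t - 1) := by rw [inv_smul_eq_iff, hγ, sub_add_cancel]
    rw [zpow_sub_one, mul_smul, h, ih]
    congr 1
    push_cast
    ring

end Action

variable {X : Type*} [MetricSpace X]

/-- If the line `α` comes close to the line `β` arbitrarily far away in both directions, then it
stays close to `β`. -/
theorem exists_near_of_cofinal {α β : ℝ → X} (hα : Isometry α) (hβ : Isometry β) {K d : ℝ}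
    (hK : 0 ≤ K) (hA : IsContracting (Set.range α) K) (hB : IsContracting (Set.range β) K)
    (htop : ∀ T, ∃ t, T ≤ t ∧ ∃ s, dist (α t) (β s) ≤ d)
    (hbot : ∀ T, ∃ t, t ≤ T ∧ ∃ s, dist (α t) (β s) ≤ d) :
    ∀ a ∈ Set.range α, ∃ b ∈ Set.range β, dist a b ≤ 6 * K := by
  rintro _ ⟨t, rfl⟩
  have hproj : ∀ u s, dist (α u) (β s) ≤ d →
      ∃ v, IsNearest (Set.range α) (β s) (α v) ∧ |u - v| ≤ 2 * d := by
    intro u s hus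
    obtain ⟨p, hp⟩ := exists_isNearest hα (β s)
    obtain ⟨v, rfl⟩ := hp.1
    refine ⟨v, hp, ?_⟩
    rw [← Real.dist_eq, ← hα.dist_eq]
    have h1 := hp.2 (α u) ⟨u, rfl⟩
    have h2 := dist_triangle (α u) (β s) (α v)
    rw [dist_comm (β s) (α u)] at h1
    linarith
  obtain ⟨t₁, ht₁, s₁, h₁⟩ := hbot (t - 3 * K - 1 - 2 * d)
  obtain ⟨t₂, ht₂, s₂, h₂⟩ := htop (t + 3 * K + 1 + 2 * d)
  obtain ⟨v₁, hv₁, hd₁⟩ := hproj t₁ s₁ h₁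
  obtain ⟨v₂, hv₂, hd₂⟩ := hproj t₂ s₂ h₂
  rw [abs_le] at hd₁ hd₂
  have e₁ : v₁ ≤ t - 3 * K - 1 := by linarith
  have e₂ : t + 3 * K + 1 ≤ v₂ := by linarith
  have hdist : ∀ x y, x ≤ y → dist (α x) (α y) = y - x := fun x y h => by
    rw [hα.dist_eq, Real.dist_eq, abs_sub_comm, abs_of_nonneg (sub_nonneg.2 h)]
  refine exists_near_of_dist_proj hA hB hK (exists_isNearest hβ) ⟨s₁, rfl⟩ ⟨s₂, rfl⟩ hv₁ hv₂ ?_ ?_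
  · rw [hdist _ _ (by linarith)]
    linarith
  · rw [hdist _ _ (by linarith), hdist _ _ (by linarith), hdist _ _ (by linarith)]
    ring

variable {G : Type*} [Group G] [MulAction G X] [IsIsometricSMul G X]

theorem isometry_smul_line (h : G) {γ : ℝ → X} (hγ : Isometry γ) : Isometry fun t => h • γ t :=
  (isometry_smul X h).comp hγ

/-- If a power of `f` translates both `α` and `β` (the latter possibly backwards), then the two
lines are parallel. -/
theorem isParallel_of_common_power {α β : ℝ → X} (hα : Isometry α) (hβ : Isometry β) {K : ℝ}
    (hK : 0 ≤ K) (hA : IsContracting (Set.range α) K) (hB : IsContracting (Set.range β) K)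
    {u : G} {m : ℕ} (hm : 0 < m) {ε : ℤ} (hε : |ε| = 1)
    (hu : ∀ (z : ℤ) (t : ℝ), u ^ z • α t = α (t + m * z))
    (hu' : ∀ (z : ℤ) (t : ℝ), u ^ z • β t = β (t + ε * (m * z))) :
    IsParallel (6 * K) (Set.range α) (Set.range β) := by
  have hm' : (1 : ℝ) ≤ m := by exact_mod_cast hm
  have hd : ∀ z : ℤ, dist (α (m * z)) (β (ε * (m * z))) ≤ dist (α 0) (β 0) := fun z => by
    have h1 := hu z 0
    have h2 := hu' z 0
    rw [zero_add] at h1 h2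
    rw [← h1, ← h2, dist_smul]
  have htop : ∀ T : ℝ, ∃ z : ℤ, T ≤ m * z := fun T => by
    refine ⟨⌈|T|⌉, (le_abs_self T).trans ((Int.le_ceil _).trans ?_)⟩
    exact le_mul_of_one_le_left (by positivity) hm'
  have hbot : ∀ T : ℝ, ∃ z : ℤ, m * (z : ℝ) ≤ T := fun T => by
    obtain ⟨z, hz⟩ := htop (-T)
    exact ⟨-z, by push_cast; linarith⟩
  refine ⟨exists_near_of_cofinal hα hβ hK hA hB (d := dist (α 0) (β 0)) (fun T => ?_)
    fun T => ?_, exists_near_of_cofinal hβ hα hK hB hA (d := dist (α 0) (β 0)) (fun T => ?_)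
    fun T => ?_⟩
  · obtain ⟨z, hz⟩ := htop T
    exact ⟨_, hz, _, hd z⟩
  · obtain ⟨z, hz⟩ := hbot T
    exact ⟨_, hz, _, hd z⟩
  · rcases (abs_eq zero_le_one).1 hε with rfl | rfl
    · obtain ⟨z, hz⟩ := htop T
      refine ⟨_, ?_, _, (dist_comm _ _).trans_le (hd z)⟩
      push_cast
      linarith
    · obtain ⟨z, hz⟩ := hbot (-T)
      refine ⟨_, ?_, _, (dist_comm _ _).trans_le (hd z)⟩
      push_cast
      linarith
  · rcases (abs_eq zero_le_one).1 hε with rfl | rfl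
    · obtain ⟨z, hz⟩ := hbot T
      refine ⟨_, ?_, _, (dist_comm _ _).trans_le (hd z)⟩
      push_cast
      linarith
    · obtain ⟨z, hz⟩ := htop (-T)
      refine ⟨_, ?_, _, (dist_comm _ _).trans_le (hd z)⟩
      push_cast
      linarith

/-- The geometric content of the WPD property: a translate of the axis with a large projection to
the axis is parallel to it. Along a long stretch where `A` and `hA` fellow travel, the elements
`f⁻ⁱ kⁱ`, where `k` is the conjugate `h f^{±1} h⁻¹` translating `hA` in the direction of `f`,
displace two far apart points of `A` by a bounded amount. By WPD two of them agree, so a power of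
`f` is also a power of `k`. -/
theorem exists_bound_proj_or_isParallel {f : G} {ax : ℝ → X} (hax : IsUnitalAxis f ax) {x₀ : X}
    (hx₀ : x₀ ∈ Set.range ax) (hf : IsWPDLoxodromic f x₀) {K : ℝ} (hK : 0 ≤ K)
    (hcon : ∀ γ : ℝ → X, Isometry γ → IsContracting (Set.range γ) K) :
    ∃ M : ℝ, ∀ h : G,
      (∀ b₁ ∈ translate h (Set.range ax), ∀ b₂ ∈ translate h (Set.range ax), ∀ p₁ p₂,
        IsNearest (Set.range ax) b₁ p₁ → IsNearest (Set.range ax) b₂ p₂ → dist p₁ p₂ ≤ M) ∨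
      IsParallel (6 * K) (Set.range ax) (translate h (Set.range ax)) := by
  obtain ⟨hα, hfα⟩ := hax
  obtain ⟨t₀, rfl⟩ := hx₀
  obtain ⟨L, -, hfin⟩ := hf.2 (48 * K + 1) (by positivity)
  set c := hfin.toFinset.card with hc
  refine ⟨L + c + 12 * K + 2, fun h => ?_⟩
  rw [translate_range]
  set β : ℝ → X := fun t => h • ax t with hβdef
  have hβ : Isometry β := isometry_smul_line h hα
  by_contra! hcontra
  obtain ⟨⟨b₁, hb₁, b₂, hb₂, p₁, p₂, hp₁, hp₂, hlong⟩, hnp⟩ := hcontra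
  obtain ⟨a, b, hab, hnear⟩ : ∃ a b : ℝ, L + c + 12 * K + 2 < b - a ∧
      ∀ t ∈ Set.Icc a b, ∃ s, dist (ax t) (β s) ≤ 6 * K := by
    have key : ∀ a b : ℝ, a ≤ b → ∀ b₁ ∈ Set.range β, ∀ b₂ ∈ Set.range β,
        IsNearest (Set.range ax) b₁ (ax a) → IsNearest (Set.range ax) b₂ (ax b) →
        L + c + 12 * K + 2 < dist (ax a) (ax b) →
        ∃ a b : ℝ, L + c + 12 * K + 2 < b - a ∧
          ∀ t ∈ Set.Icc a b, ∃ s, dist (ax t) (β s) ≤ 6 * K := by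
      intro a b hab b₁ hb₁ b₂ hb₂ hp₁ hp₂ hlong
      have hdist : ∀ x y, x ≤ y → dist (ax x) (ax y) = y - x := fun x y h => by
        rw [hα.dist_eq, Real.dist_eq, abs_sub_comm, abs_of_nonneg (sub_nonneg.2 h)]
      refine ⟨a, b, by rwa [hdist _ _ hab] at hlong, fun t ht => ?_⟩
      obtain ⟨_, ⟨s, rfl⟩, hs⟩ := exists_near_of_dist_proj (p := ax t) (hcon _ hα) (hcon _ hβ) hK
        (exists_isNearest hβ) hb₁ hb₂ hp₁ hp₂ (by
          have : (0 : ℝ) ≤ L + c := by positivity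
          linarith) (by
          rw [hdist _ _ hab, hdist _ _ ht.1, hdist _ _ ht.2]
          ring)
      exact ⟨s, hs⟩
    obtain ⟨a, rfl⟩ := hp₁.1
    obtain ⟨b, rfl⟩ := hp₂.1
    rcases le_total a b with hab | hab
    · exact key a b hab b₁ hb₁ b₂ hb₂ hp₁ hp₂ hlong
    · exact key b a hab b₂ hb₂ b₁ hb₁ hp₂ hp₁ (by rwa [dist_comm])
  choose! s hs using hnear
  obtain ⟨ε, hε, hsε⟩ := exists_sign_of_coarse_isometry (s := s) (a := a) (b := b) (c := 12 * K)
    (by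
      have : (0 : ℝ) ≤ L + c := by positivity
      linarith) (by
      intro t ht u hu
      rw [← Real.dist_eq (s t), ← Real.dist_eq t, ← hβ.dist_eq (s t), ← hα.dist_eq t]
      have h1 := hs t ht
      have h2 := hs u hu
      have h3 := dist_triangle4 (β (s t)) (ax t) (ax u) (β (s u))
      have h4 := dist_triangle4 (ax t) (β (s t)) (β (s u)) (ax u)
      rw [dist_comm (β (s t)) (ax t)] at h3
      rw [dist_comm (β (s u)) (ax u)] at h4
      rw [abs_le]
      constructor <;> linarith)
  set k : G := h * f ^ ε * h⁻¹ with hk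
  have hkβ : ∀ (z : ℤ) (t : ℝ), k ^ z • β t = β (t + ε * z) := by
    intro z t
    have : k ^ z = h * f ^ (ε * z) * h⁻¹ := by rw [hk, conj_zpow, zpow_mul]
    rw [this, hβdef]
    simp only [mul_smul, inv_smul_smul, zpow_smul_line hfα]
    push_cast
    rfl
  have hshift : ∀ (i : ℕ) (t : ℝ), t ∈ Set.Icc a b → t + i ∈ Set.Icc a b →
      dist (ax (t + i)) (k ^ (i : ℤ) • ax t) < 48 * K + 1 := by
    intro i t ht hti
    have h1 := hs t ht
    have h2 := hs _ hti
    have h3 := hsε t ht _ hti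
    rw [← dist_smul (k ^ (i : ℤ)), hkβ] at h1
    have h4 : dist (β (s (t + i))) (β (s t + ε * (i : ℤ))) ≤ 36 * K := by
      rw [hβ.dist_eq, Real.dist_eq]
      have e : s (t + i) - (s t + ε * ((i : ℤ) : ℝ)) = s (t + i) - s t - ε * (t + i - t) := by
        push_cast
        ring
      rw [e]
      linarith
    have h5 := dist_triangle4 (ax (t + i)) (β (s (t + i))) (β (s t + ε * (i : ℤ)))
      (k ^ (i : ℤ) • ax t)
    rw [dist_comm (β (s t + ε * (i : ℤ)))] at h5
    linarith
  -- `f ^ n` moves the base point to the beginning of the fellow travelling stretch.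
  set n : ℤ := ⌈a - t₀⌉ with hn
  have hn1 : a - t₀ ≤ n := Int.le_ceil _
  have hn2 : (n : ℝ) < a - t₀ + 1 := Int.ceil_lt_add_one _
  set w : ℕ → G := fun i => f ^ (-n) * f ^ (-(i : ℤ)) * k ^ (i : ℤ) * f ^ n with hw
  have hwd : ∀ (i : ℕ) (t : ℝ), t + n ∈ Set.Icc a b → t + n + i ∈ Set.Icc a b →
      dist (ax t) (w i • ax t) < 48 * K + 1 := by
    intro i t ht hti
    have h1 := hshift i (t + n) ht hti
    rw [← dist_smul (f ^ (-n) * f ^ (-(i : ℤ)))] at h1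
    simp only [hw, mul_smul, zpow_smul_line hfα] at h1 ⊢
    convert h1 using 3
    push_cast
    ring
  have hmaps : ∀ i ∈ Finset.range (c + 1), w i ∈ hfin.toFinset := by
    intro i hi
    have hi : (i : ℝ) ≤ c := by exact_mod_cast Nat.lt_succ_iff.1 (Finset.mem_range.1 hi)
    have hi0 : (0 : ℝ) ≤ i := by positivity
    have hL : (0 : ℝ) ≤ L := by positivity
    rw [Set.Finite.mem_toFinset]
    refine ⟨hwd i t₀ ⟨?_, ?_⟩ ⟨?_, ?_⟩, ?_⟩
    any_goals linarith
    have : f ^ L • ax t₀ = ax (t₀ + L) := by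
      have := zpow_smul_line hfα (L : ℤ) t₀
      simpa using this
    rw [this]
    refine hwd i _ ⟨?_, ?_⟩ ⟨?_, ?_⟩
    all_goals linarith
  obtain ⟨i, j, hij, hwij⟩ : ∃ i j : ℕ, i < j ∧ w i = w j := by
    obtain ⟨i, -, j, -, hne, heq⟩ := Finset.exists_ne_map_eq_of_card_lt_of_maps_to
      (by rw [Finset.card_range]; exact Nat.lt_succ_self c) hmaps
    rcases lt_or_gt_of_ne hne with hlt | hlt
    exacts [⟨i, j, hlt, heq⟩, ⟨j, i, hlt, heq.symm⟩]
  have hpow : f ^ (j - i) = k ^ (j - i) := by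
    obtain ⟨m, rfl⟩ := Nat.exists_eq_add_of_le' hij.le
    simp only [hw, mul_assoc, mul_right_inj] at hwij
    rw [← mul_assoc, ← mul_assoc, mul_left_inj] at hwij
    simp only [zpow_neg, zpow_natCast, pow_add, mul_inv_rev, mul_assoc, mul_right_inj] at hwij
    rw [← mul_assoc, right_eq_mul, inv_mul_eq_one] at hwij
    rwa [Nat.add_sub_cancel]
  refine hnp (isParallel_of_common_power hα hβ hK (hcon _ hα) (hcon _ hβ) (u := f ^ (j - i))
    (m := j - i) (Nat.sub_pos_of_lt hij) hε (fun z t => ?_) fun z t => ?_)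
  · rw [← zpow_natCast, ← zpow_mul, zpow_smul_line hfα]
    push_cast
    rfl
  · rw [hpow, ← zpow_natCast, ← zpow_mul, hkβ]
    push_cast
    rfl

end WPD

/-! ### Paths and obstructing axes -/

section Combinatorics

/-- The coarse geometry of a family of axes seen from a base point `x₀`: projections `proj h` to
the axes, a point `base h` on each axis, the relation `Near` of being parallel, and the distance
`rank h` from `x₀` to the axis. Parallel axes have the same projection distances up to `θ`, axes
that are not parallel satisfy Behrstock's inequality, and an axis `k` which, seen from `x₀`, lies beyond
some stretch of the axis `h` is farther from `x₀` than `h`. -/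
structure AxisSystem (I X : Type*) [MetricSpace X] (x₀ : X) (θ : ℝ) where
  /-- The projection to the axis of index `h`. -/
  proj : I → X → X
  /-- A point on the axis of index `h`. -/
  base : I → X
  /-- The distance from `x₀` to the axis of index `h`. -/
  rank : I → ℝ
  /-- The axes of the two indices are parallel. -/
  Near : I → I → Prop
  pos : 0 < θ
  rank_nonneg : ∀ h, 0 ≤ rank h
  near_symm : ∀ h k, Near h k → Near k h
  dist_le_of_near : ∀ h k x y, Near h k →
    dist (proj h x) (proj h y) ≤ dist (proj k x) (proj k y) + θ
  behrstock : ∀ h k x, ¬ Near h k →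
    dist (proj h x) (proj h (base k)) ≤ θ ∨ dist (proj k x) (proj k (base h)) ≤ θ
  rank_add_one_le : ∀ h k, ¬ Near h k → θ < dist (proj h x₀) (proj h (base k)) →
    rank h + 1 ≤ rank k

namespace AxisSystem

variable {I X : Type*} [MetricSpace X] {x₀ : X} {θ : ℝ} (S : AxisSystem I X x₀ θ)

/-- The distance from `x₀` to `y` measured by projecting to the axis `h`. -/
def size (h : I) (y : X) : ℝ := dist (S.proj h x₀) (S.proj h y)

/-- The axis `h` precedes the axis `k`, as seen from `x₀`. -/
def Before (h k : I) : Prop := ¬ S.Near h k ∧ dist (S.proj k x₀) (S.proj k (S.base h)) ≤ θ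

theorem before_or_before {h k : I} (hhk : ¬ S.Near h k) : S.Before h k ∨ S.Before k h :=
  (S.behrstock h k x₀ hhk).symm.imp (fun h' => ⟨hhk, h'⟩)
    fun h' => ⟨fun h'' => hhk (S.near_symm _ _ h''), h'⟩

variable {S}

/-- Beyond a later axis `k`, all points project to the same place of an earlier axis `h`. -/
theorem Before.dist_proj_base_le {h k : I} (hhk : S.Before h k) {y : X}
    (hy : 2 * θ < S.size k y) : dist (S.proj h y) (S.proj h (S.base k)) ≤ θ := by
  refine (S.behrstock h k y hhk.1).resolve_right fun hle => ?_
  have h1 := dist_triangle_right (S.proj k x₀) (S.proj k y) (S.proj k (S.base h))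
  have h2 := hhk.2
  rw [size] at hy
  linarith

theorem Before.abs_size_sub_le {h k : I} (hhk : S.Before h k) {y z : X}
    (hy : 2 * θ < S.size k y) (hz : 2 * θ < S.size k z) :
    |S.size h y - S.size h z| ≤ 2 * θ := by
  have h1 := hhk.dist_proj_base_le hy
  have h2 := hhk.dist_proj_base_le hz
  have h3 := dist_triangle_right (S.proj h y) (S.proj h z) (S.proj h (S.base k))
  have h4 := dist_triangle (S.proj h x₀) (S.proj h y) (S.proj h z)
  have h5 := dist_triangle_right (S.proj h x₀) (S.proj h y) (S.proj h z)
  rw [size, size, abs_le]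
  constructor <;> linarith

theorem Before.rank_add_one_le {h k : I} (hhk : S.Before h k) {y : X}
    (hy : 2 * θ < S.size h y) (hy' : 2 * θ < S.size k y) : S.rank h + 1 ≤ S.rank k := by
  refine S.rank_add_one_le h k hhk.1 ?_
  have h1 := hhk.dist_proj_base_le hy'
  have h2 := dist_triangle_right (S.proj h x₀) (S.proj h y) (S.proj h (S.base k))
  rw [size] at hy
  linarith

theorem size_le_of_near {h k : I} (hhk : S.Near h k) (y : X) : S.size h y ≤ S.size k y + θ :=
  S.dist_le_of_near h k x₀ y hhk

variable (S)

/-- Among the axes with a given property there is one of smallest rank, up to an error less than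
one, which is the least difference of ranks between consecutive axes. -/
theorem exists_rank_lt_add_one {P : I → Prop} (hP : ∃ h, P h) :
    ∃ h, P h ∧ ∀ k, P k → S.rank h < S.rank k + 1 := by
  obtain ⟨h, hh, hmin⟩ :=
    WellFounded.has_min (InvImage.wf (fun h => ⌊S.rank h⌋₊) Nat.lt_wfRel.wf) {h | P h} hP
  refine ⟨h, hh, fun k hk => ?_⟩
  have h1 : ⌊S.rank h⌋₊ ≤ ⌊S.rank k⌋₊ := not_lt.1 (hmin k hk)
  have h2 : (⌊S.rank h⌋₊ : ℝ) ≤ ⌊S.rank k⌋₊ := by exact_mod_cast h1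
  have h3 := Nat.lt_floor_add_one (S.rank h)
  have h4 := Nat.floor_le (S.rank_nonneg k)
  linarith

/-- Axes of the same rank, up to rounding, with large `size` are parallel. -/
theorem near_of_floor_rank_eq {h k : I} {y : X} (hh : 2 * θ < S.size h y)
    (hk : 2 * θ < S.size k y) (heq : ⌊S.rank h⌋₊ = ⌊S.rank k⌋₊) : S.Near h k := by
  by_contra hn
  have h1 := Nat.lt_floor_add_one (S.rank h)
  have h2 := Nat.lt_floor_add_one (S.rank k)
  have h3 := Nat.floor_le (S.rank_nonneg h)
  have h4 := Nat.floor_le (S.rank_nonneg k)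
  rw [heq] at h1 h3
  rcases S.before_or_before hn with h5 | h5
  · linarith [h5.rank_add_one_le hh hk]
  · linarith [h5.rank_add_one_le hk hh]

/-- Up to parallelism, only finitely many axes have a large `size` at a given point. -/
theorem exists_finite_near {y : X} {R : ℝ} (hR : ∀ h, 2 * θ < S.size h y → S.rank h ≤ R) :
    ∃ F : Set I, F.Finite ∧ ∀ h, 2 * θ < S.size h y → ∃ k ∈ F, S.Near h k := by
  obtain ⟨F, hF, hbij⟩ := Set.exists_subset_bijOn {h | 2 * θ < S.size h y} fun h => ⌊S.rank h⌋₊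
  refine ⟨F, hbij.finite_iff_finite.2 ((Set.finite_Iic ⌊R⌋₊).subset ?_), fun h hh => ?_⟩
  · rintro _ ⟨h, hh, rfl⟩
    exact Nat.floor_mono (hR h hh)
  · obtain ⟨k, hk, heq⟩ := hbij.surjOn ⟨h, hh, rfl⟩
    exact ⟨k, hk, S.near_of_floor_rank_eq hh (hF hk) heq.symm⟩

end AxisSystem

theorem exists_and_not_succ {P : ℕ → Prop} {t N : ℕ} (htN : t ≤ N) (ht : P t) (hN : ¬ P N) :
    ∃ s, t ≤ s ∧ s < N ∧ P s ∧ ¬ P (s + 1) := by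
  by_contra! h
  have : ∀ n, t ≤ n → n ≤ N → P n := by
    intro n hn
    induction n, hn using Nat.le_induction with
    | base => exact fun _ => ht
    | succ n hn ih => exact fun hle => h n hn (by omega) (ih (by omega))
  exact hN (this N htN le_rfl)

namespace AxisSystem

variable {I X : Type*} [MetricSpace X] {x₀ : X} {θ : ℝ} {S : AxisSystem I X x₀ θ}

/-- The axis `B` controls the path `y` at time `t`, relative to the axis `A`: the path has covered
between `99D` and `201D` along `B`, and at all times when its `B`-coordinate is about the same as at
time `t`, its `A`-coordinate is about `100D` and all large projections occur on axes after `B`. -/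
def Controls (S : AxisSystem I X x₀ θ) (D : ℝ) (N : ℕ) (y : ℕ → X) (A B : I) (t : ℕ) : Prop :=
  99 * D ≤ S.size B (y t) ∧ S.size B (y t) ≤ 201 * D ∧
    ∀ s ≤ N, |S.size B (y s) - S.size B (y t)| ≤ 2 * θ →
      (90 * D ≤ S.size A (y s) ∧ S.size A (y s) ≤ 110 * D) ∧
        ∀ h, 299 * D ≤ S.size h (y s) → S.Before B h

/-- The first axis `A` along which the endpoint of a path is far away controls the path when its
`A`-coordinate crosses `100D`. -/
theorem exists_controls_self {D : ℝ} (hD : 100 * θ ≤ D) {N : ℕ} {y : ℕ → X} (hy0 : y 0 = x₀)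
    (hstep : ∀ i < N, ∀ h, dist (S.proj h (y i)) (S.proj h (y (i + 1))) ≤ D) {A : I}
    (hA : 260 * D ≤ S.size A (y N))
    (hfirst : ∀ k, 260 * D ≤ S.size k (y N) → S.rank A < S.rank k + 1) :
    ∃ t ≤ N, S.Controls D N y A A t := by
  have hθ := S.pos
  obtain ⟨r, -, hrN, hr, hr'⟩ := exists_and_not_succ (P := fun s => S.size A (y s) < 100 * D)
    (Nat.zero_le N) (by simp only [hy0, size, dist_self]; linarith) (by rw [not_lt]; linarith)
  rw [not_lt] at hr'
  have hcross : S.size A (y (r + 1)) ≤ 101 * D := by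
    have := dist_triangle (S.proj A x₀) (S.proj A (y r)) (S.proj A (y (r + 1)))
    have := hstep r hrN A
    rw [size] at hr ⊢
    linarith
  refine ⟨r + 1, hrN, by linarith, by linarith, fun s hs hsize => ?_⟩
  rw [abs_le] at hsize
  refine ⟨⟨by linarith, by linarith⟩, fun h hh => ?_⟩
  have hn : ¬ S.Near A h := fun hn => by
    linarith [size_le_of_near (S.near_symm _ _ hn) (y s)]
  refine (S.before_or_before hn).resolve_right fun hb => ?_
  have h1 := hb.abs_size_sub_le (y := y s) (z := y N) (by linarith) (by linarith)
  rw [abs_le] at h1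
  have h2 := hb.rank_add_one_le (y := y N) (by linarith) (by linarith)
  linarith [hfirst h (by linarith)]

/-- If at time `t` there is a large projection, then the first axis after `B` with a large
projection controls the path at a later time when the path is about to leave it. -/
theorem Controls.exists_gt {D : ℝ} (hD : 100 * θ ≤ D) {N : ℕ} {y : ℕ → X}
    (hstep : ∀ i < N, ∀ h, dist (S.proj h (y i)) (S.proj h (y (i + 1))) ≤ D) {A B : I}
    (hA : 260 * D ≤ S.size A (y N)) {t : ℕ} (htN : t ≤ N) (ht : S.Controls D N y A B t)
    (hobst : ∃ h, 299 * D ≤ S.size h (y t)) : ∃ t' ≤ N, t < t' ∧ ∃ h, S.Controls D N y A h t' := by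
  have hθ := S.pos
  obtain ⟨hB1, hB2, hgood⟩ := ht
  obtain ⟨h₀, hh₀⟩ := hobst
  obtain ⟨h, ⟨hh, hBh⟩, hmin⟩ := S.exists_rank_lt_add_one
    (P := fun h => 298 * D ≤ S.size h (y t) ∧ S.Before B h)
    ⟨h₀, by linarith, (hgood t htN (by simp only [sub_self, abs_zero]; linarith)).2 h₀ hh₀⟩
  -- Whenever the path is far along `h`, its `B`-coordinate is that of time `t`.
  have hback : ∀ s, 2 * θ < S.size h (y s) → |S.size B (y s) - S.size B (y t)| ≤ 2 * θ :=
    fun s hs => hBh.abs_size_sub_le hs (by linarith)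
  have hN : ¬ 200 * D ≤ S.size h (y N) := fun hle => by
    linarith [(hgood N le_rfl (hback N (by linarith))).1.2]
  obtain ⟨s, hts, hsN, hs, hs'⟩ := exists_and_not_succ (P := fun s => 200 * D ≤ S.size h (y s))
    htN (by linarith) hN
  rw [not_le] at hs'
  have hcross : S.size h (y s) ≤ 201 * D := by
    have := dist_triangle_right (S.proj h x₀) (S.proj h (y s)) (S.proj h (y (s + 1)))
    have := hstep s hsN h
    rw [size] at hs' ⊢
    linarith
  have hne : t ≠ s := by
    rintro rfl
    linarith
  refine ⟨s, hsN.le, lt_of_le_of_ne hts hne, h, by linarith, hcross, fun r hr hsize => ?_⟩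
  rw [abs_le] at hsize
  obtain ⟨hAr, hafter⟩ := hgood r hr (hback r (by linarith))
  refine ⟨hAr, fun k hk => ?_⟩
  have hn : ¬ S.Near h k := fun hn => by
    linarith [size_le_of_near (S.near_symm _ _ hn) (y r)]
  refine (S.before_or_before hn).resolve_right fun hb => ?_
  -- An axis `k` between `B` and `h` would already have had a large projection at time `t`.
  have h1 := hb.abs_size_sub_le (y := y r) (z := y t) (by linarith) (by linarith)
  rw [abs_le] at h1
  have h2 := hb.rank_add_one_le (y := y t) (by linarith) (by linarith)
  linarith [hmin k ⟨by linarith, hafter k hk⟩]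

/-- A path whose endpoint is far along some axis passes, while it is far along such an axis, a
point without large projections. -/
theorem exists_time_forall_size_lt (S : AxisSystem I X x₀ θ) {D : ℝ} (hD : 100 * θ ≤ D) {N : ℕ}
    {y : ℕ → X} (hy0 : y 0 = x₀)
    (hstep : ∀ i < N, ∀ h, dist (S.proj h (y i)) (S.proj h (y (i + 1))) ≤ D)
    (hfar : ∃ A, 260 * D ≤ S.size A (y N)) :
    ∃ t ≤ N, ∃ A, 260 * D ≤ S.size A (y N) ∧ 90 * D ≤ S.size A (y t) ∧
      ∀ h, S.size h (y t) < 299 * D := by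
  have hθ := S.pos
  obtain ⟨A, hA, hfirst⟩ := S.exists_rank_lt_add_one hfar
  by_contra! hno
  have key : ∀ n, ∃ t ≤ N, n ≤ t ∧ ∃ B, S.Controls D N y A B t := by
    intro n
    induction n with
    | zero =>
      obtain ⟨t, htN, ht⟩ := exists_controls_self hD hy0 hstep hA hfirst
      exact ⟨t, htN, Nat.zero_le _, A, ht⟩
    | succ n ih =>
      obtain ⟨t, htN, hnt, B, ht⟩ := ih
      have hAt := (ht.2.2 t htN (by simp only [sub_self, abs_zero]; linarith)).1.1
      obtain ⟨t', ht'N, htt', h, hh⟩ := ht.exists_gt hD hstep hA htN (hno t htN A hA hAt)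
      exact ⟨t', ht'N, by omega, h, hh⟩
  obtain ⟨t, htN, hNt, -⟩ := key (N + 1)
  omega

end AxisSystem

end Combinatorics

/-! ### The word metric -/

section Word

variable {G : Type*} [Group G] {S : Set G}

theorem exists_list_of_wordDist (hS : Subgroup.closure S = ⊤) (g h : G) :
    ∃ l : List G, l.length = wordDist S g h ∧ (∀ s ∈ l, s ∈ S ∨ s⁻¹ ∈ S) ∧ h = g * l.prod := by
  refine Nat.sInf_mem
    (s := {n | ∃ l : List G, l.length = n ∧ (∀ s ∈ l, s ∈ S ∨ s⁻¹ ∈ S) ∧ h = g * l.prod}) ?_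
  have hmem : g⁻¹ * h ∈ Submonoid.closure (S ∪ S⁻¹) := by
    rw [← Subgroup.closure_toSubmonoid, hS]
    exact Subgroup.mem_top _
  obtain ⟨l, hl, hprod⟩ := Submonoid.exists_list_of_mem_closure hmem
  exact ⟨l.length, l, rfl, hl, by rw [hprod, mul_inv_cancel_left]⟩

theorem finite_setOf_list_prod (hS : S.Finite) (n : ℕ) :
    {u : G | ∃ l : List G, l.length = n ∧ (∀ s ∈ l, s ∈ S ∨ s⁻¹ ∈ S) ∧ u = l.prod}.Finite := by
  induction n with
  | zero =>
    refine (Set.finite_singleton 1).subset ?_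
    rintro u ⟨l, hl, -, rfl⟩
    rw [List.length_eq_zero_iff.1 hl]
    rfl
  | succ n ih =>
    have hT : (S ∪ (·⁻¹) '' S).Finite := hS.union (hS.image _)
    refine (hT.image2 (· * ·) ih).subset ?_
    rintro u ⟨l, hl, hmem, rfl⟩
    obtain ⟨a, l, rfl⟩ := List.exists_cons_of_length_eq_add_one hl
    refine ⟨a, ?_, l.prod, ⟨l, by simpa using hl, fun s hs => hmem s (List.mem_cons_of_mem _ hs),
      rfl⟩, by simp⟩
    exact (hmem a List.mem_cons_self).imp id fun h => ⟨_, h, inv_inv a⟩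

theorem finite_setOf_wordNorm_lt (hS : S.Finite) (hgen : Subgroup.closure S = ⊤) (E : ℝ) :
    {u : G | (wordNorm S u : ℝ) < E}.Finite := by
  refine ((Set.finite_Iic ⌊E⌋₊).biUnion fun n _ => finite_setOf_list_prod hS n).subset ?_
  intro u hu
  obtain ⟨l, hl, hmem, hprod⟩ := exists_list_of_wordDist hgen 1 u
  exact Set.mem_biUnion (x := wordNorm S u) (Nat.le_floor (le_of_lt hu))
    ⟨l, hl, hmem, by rw [hprod, one_mul]⟩

variable {X : Type*} [MetricSpace X] [MulAction G X] [IsIsometricSMul G X]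

theorem exists_dist_smul_le (hS : S.Finite) (hgen : Subgroup.closure S = ⊤) (x : X) :
    ∃ C, 0 ≤ C ∧ ∀ g h : G, wordDist S g h ≤ 1 → dist (g • x) (h • x) ≤ C := by
  obtain ⟨C, hC⟩ := (hS.image fun s => dist x (s • x)).bddAbove
  refine ⟨max C 0, le_max_right _ _, fun g h hgh => ?_⟩
  obtain ⟨l, hl, hmem, rfl⟩ := exists_list_of_wordDist hgen g h
  rw [mul_smul, dist_smul]
  rcases Nat.le_one_iff_eq_zero_or_eq_one.1 (hl.trans_le hgh) with h0 | h1
  · rw [List.length_eq_zero_iff.1 h0]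
    simp
  · obtain ⟨s, rfl⟩ := List.length_eq_one_iff.1 h1
    rw [List.prod_singleton]
    refine le_trans ?_ (le_max_left _ _)
    rcases hmem s (by simp) with hs | hs
    · exact hC ⟨s, hs, rfl⟩
    · refine le_trans (le_of_eq ?_) (hC ⟨_, hs, rfl⟩)
      dsimp only
      rw [← dist_smul s x (s⁻¹ • x), smul_inv_smul, dist_comm]

end Word

/-! ### The system of translates of the axis -/

section Translates

variable {G : Type*} [Group G] {X : Type*} [MulAction G X]

theorem translate_mul (g h : G) (A : Set X) :
    translate (g * h) A = translate g (translate h A) := by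
  simp only [translate, Set.image_image, mul_smul]

theorem translate_inv_translate (g h : G) (A : Set X) :
    translate g⁻¹ (translate h A) = translate (g⁻¹ * h) A := (translate_mul _ _ _).symm

theorem translate_one (A : Set X) : translate (1 : G) A = A := by
  simp [translate]

end Translates

section Translates

variable {G : Type*} [Group G] {X : Type*} [MetricSpace X] [MulAction G X] [IsIsometricSMul G X]

theorem IsNearest.translate {A : Set X} {x p : X} (h : IsNearest A x p) (g : G) :
    IsNearest (translate g A) (g • x) (g • p) := by
  refine ⟨⟨p, h.1, rfl⟩, ?_⟩
  rintro _ ⟨y, hy, rfl⟩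
  simpa only [dist_smul] using h.2 y hy

theorem IsParallel.translate {c : ℝ} {A B : Set X} (h : IsParallel c A B) (g : G) :
    IsParallel c (translate g A) (translate g B) := by
  constructor
  · rintro _ ⟨a, ha, rfl⟩
    obtain ⟨b, hb, hab⟩ := h.1 a ha
    exact ⟨g • b, ⟨b, hb, rfl⟩, by rwa [dist_smul]⟩
  · rintro _ ⟨b, hb, rfl⟩
    obtain ⟨a, ha, hab⟩ := h.2 b hb
    exact ⟨g • a, ⟨a, ha, rfl⟩, by rwa [dist_smul]⟩

/-- The translates of the axis of a WPD element form an axis system. -/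
theorem exists_axisSystem {f : G} {ax : ℝ → X} (hax : IsUnitalAxis f ax) {x₀ : X}
    (hx₀ : x₀ ∈ Set.range ax) (hf : IsWPDLoxodromic f x₀) {K : ℝ} (hK : 0 ≤ K)
    (hcon : ∀ γ : ℝ → X, Isometry γ → IsContracting (Set.range γ) K) :
    ∃ (θ : ℝ) (T : AxisSystem G X x₀ θ), K ≤ θ ∧
      (∀ h x, IsNearest (translate h (Set.range ax)) x (T.proj h x)) ∧
      ∀ h, T.rank h = dist x₀ (T.proj h x₀) := by
  obtain ⟨M₀, hM₀⟩ := exists_bound_proj_or_isParallel hax hx₀ hf hK hcon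
  set A : G → Set X := fun h => translate h (Set.range ax) with hA
  have hcontr : ∀ h, IsContracting (A h) K := fun h => by
    simp only [hA, translate_range]
    exact hcon _ (isometry_smul_line h hax.1)
  have hex : ∀ h x, ∃ p, IsNearest (A h) x p := fun h x => by
    simp only [hA, translate_range]
    exact exists_isNearest (isometry_smul_line h hax.1) x
  choose π hπ using hex
  have hbase : ∀ h : G, h • x₀ ∈ A h := fun h => ⟨x₀, hx₀, rfl⟩
  set M := max M₀ 0 with hM
  have hM0 : 0 ≤ M := le_max_right _ _
  have hbound : ∀ h k, ¬ IsParallel (6 * K) (A h) (A k) → ∀ b₁ ∈ A k, ∀ b₂ ∈ A k, ∀ p₁ p₂,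
      IsNearest (A h) b₁ p₁ → IsNearest (A h) b₂ p₂ → dist p₁ p₂ ≤ M := by
    intro h k hhk b₁ hb₁ b₂ hb₂ p₁ p₂ hp₁ hp₂
    have hmem : ∀ b ∈ A k, h⁻¹ • b ∈ translate (h⁻¹ * k) (Set.range ax) := fun b hb => by
      rw [← translate_inv_translate]
      exact ⟨b, hb, rfl⟩
    have hnear : ∀ b p, IsNearest (A h) b p → IsNearest (Set.range ax) (h⁻¹ • b) (h⁻¹ • p) :=
      fun b p hp => by
        have := hp.translate h⁻¹
        rwa [hA, translate_inv_translate, inv_mul_cancel, translate_one] at this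
    rcases hM₀ (h⁻¹ * k) with hle | hpar
    · rw [← dist_smul h⁻¹]
      exact (hle _ (hmem _ hb₁) _ (hmem _ hb₂) _ _ (hnear _ _ hp₁) (hnear _ _ hp₂)).trans
        (le_max_left _ _)
    · have := hpar.translate h
      rw [← translate_mul, mul_inv_cancel_left] at this
      exact absurd this hhk
  refine ⟨M + 38 * K + 1,
    { proj := π
      base := fun h => h • x₀
      rank := fun h => dist x₀ (π h x₀)
      Near := fun h k => IsParallel (6 * K) (A h) (A k)
      pos := by positivity
      rank_nonneg := fun h => dist_nonneg
      near_symm := fun h k hhk => hhk.symm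
      dist_le_of_near := fun h k x y hhk => ?_
      behrstock := fun h k x hhk => ?_
      rank_add_one_le := fun h k hhk hlt => ?_ }, by linarith, hπ, fun h => rfl⟩
  · have h1 := hhk.dist_proj_le (hcontr k) (hπ h x) (hπ k x)
    have h2 := hhk.dist_proj_le (hcontr k) (hπ h y) (hπ k y)
    have h3 := dist_triangle4 (π h x) (π k x) (π k y) (π h y)
    rw [dist_comm (π k y) (π h y)] at h3
    linarith
  · refine (dist_proj_le_or_dist_proj_le (M := M) (hcontr h) (hcontr k) hK (hbase h)
      (hbase k) (hπ h x) (hπ k x) (hπ h _) (hπ k _) (fun z => ⟨_, hπ h z⟩) (fun z => ⟨_, hπ k z⟩)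
      (hbound h k hhk) (hbound k h fun h' => hhk h'.symm)).imp ?_ ?_ <;> intro hle <;> linarith
  · have h1 := hbound h k hhk _ (hπ k x₀).1 _ (hbase k) _ _ (hπ h _) (hπ h _)
    have h2 := dist_triangle (π h x₀) (π h (π k x₀)) (π h (k • x₀))
    have h3 := (hcontr h _ _ _ _ (hπ h x₀) (hπ h (π k x₀))).resolve_left (by linarith)
    linarith [dist_nonneg (x := π h (π k x₀)) (y := π k x₀)]

end Translates

/-- An axis on which some element of word norm less than `E` has a large projection is parallel to a
translate of the original axis by an element whose norm is bounded in terms of `E`. -/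
theorem exists_wordNorm_bound {G : Type*} [Group G] {X : Type*} [MetricSpace X] [MulAction G X]
    {S : Set G} (hSfin : S.Finite) (hSgen : Subgroup.closure S = ⊤) {x₀ : X} {θ : ℝ}
    (T : AxisSystem G X x₀ θ)
    (hR : ∀ y, ∃ R, ∀ h, 2 * θ < T.size h y → T.rank h ≤ R) (E : ℝ) :
    ∃ E' : ℝ, ∀ u : G, (wordNorm S u : ℝ) < E → ∀ h, 2 * θ < T.size h (u • x₀) →
      ∃ k, (wordNorm S k : ℝ) ≤ E' ∧ T.Near h k := by
  have hfin : ∀ u : G, ∃ F : Set G, F.Finite ∧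
      ∀ h, 2 * θ < T.size h (u • x₀) → ∃ k ∈ F, T.Near h k := fun u => by
    obtain ⟨R, hR⟩ := hR (u • x₀)
    exact T.exists_finite_near hR
  choose F hF hnear using hfin
  obtain ⟨c, hc⟩ := (((finite_setOf_wordNorm_lt hSfin hSgen E).biUnion fun u _ => hF u).image
    fun k => (wordNorm S k : ℝ)).bddAbove
  refine ⟨c, fun u hu h hh => ?_⟩
  obtain ⟨k, hk, hhk⟩ := hnear u h hh
  exact ⟨k, hc ⟨k, Set.mem_biUnion hu hk, rfl⟩, hhk⟩

end WPDBarrier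

theorem mainTheorem8 {G : Type*} [Group G] {X : Type*} [MetricSpace X] [MulAction G X]
    [IsIsometricSMul G X]
    (hG : ¬ WPDBarrier.VirtuallyCyclic G)
    (S : Set G) (hSfin : S.Finite) (hSgen : Subgroup.closure S = ⊤)
    (hgeo : WPDBarrier.IsGeodesicSpace X)
    (δ : ℝ) (hδ : 0 < δ) (hhyp : WPDBarrier.IsHyperbolicSpace X δ)
    (f : G) (ax : ℝ → X) (hax : WPDBarrier.IsUnitalAxis f ax)
    (x₀ : X) (hx₀ : x₀ ∈ Set.range ax)
    (hf : WPDBarrier.IsWPDLoxodromic f x₀) :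
    ∃ D₀ > (0 : ℝ), ∃ E₀ > (0 : ℝ), ∀ D ≥ D₀, ∀ E ≥ E₀, ∃ E' > (0 : ℝ), ∀ g : G,
      (¬ ∃ h : G, (WPDBarrier.wordNorm S h : ℝ) ≤ E' ∧
        250 * D ≤ WPDBarrier.projDist (WPDBarrier.translate h (Set.range ax)) x₀ (g • x₀)) →
      E ≤ (WPDBarrier.wordNorm S g : ℝ) →
      ∀ (N : ℕ) (p : ℕ → G), WPDBarrier.IsWordPath S 1 g N p →
        ∃ t ≤ N, p t ∈ WPDBarrier.NFge S (Set.range ax) x₀ (300 * D) E := by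
  obtain ⟨K, hK, hcon⟩ : ∃ K : ℝ, 0 ≤ K ∧
      ∀ γ : ℝ → X, Isometry γ → WPDBarrier.IsContracting (Set.range γ) K :=
    ⟨22 * δ, by positivity, fun γ hγ => WPDBarrier.isContracting_range hgeo hδ hhyp hγ⟩
  obtain ⟨θ, T, hKθ, hT, hrank⟩ := WPDBarrier.exists_axisSystem hax hx₀ hf hK hcon
  have hθ := T.pos
  obtain ⟨C, hC0, hC⟩ := WPDBarrier.exists_dist_smul_le (X := X) hSfin hSgen x₀
  have hcontr : ∀ h : G,
      WPDBarrier.IsContracting (WPDBarrier.translate h (Set.range ax)) K := fun h => by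
    rw [WPDBarrier.translate_range]
    exact hcon _ (WPDBarrier.isometry_smul_line h hax.1)
  have hproj : ∀ h y,
      T.size h y ≤ WPDBarrier.projDist (WPDBarrier.translate h (Set.range ax)) x₀ y ∧
      WPDBarrier.projDist (WPDBarrier.translate h (Set.range ax)) x₀ y ≤ T.size h y + 2 * K :=
    fun h y => (hcontr h).le_projDist_and_projDist_le hK (hT h x₀) (hT h y)
  refine ⟨100 * (θ + K + C), by positivity, 1, one_pos, fun D hD E _ => ?_⟩
  have hDθ : 100 * θ ≤ D := by linarith
  obtain ⟨c, hc⟩ := WPDBarrier.exists_wordNorm_bound hSfin hSgen T (fun y => by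
    refine ⟨dist x₀ y + K, fun h hh => ?_⟩
    rw [WPDBarrier.AxisSystem.size] at hh
    rw [hrank]
    linarith [(hcontr h _ _ _ _ (hT h x₀) (hT h y)).resolve_left (by linarith),
      dist_nonneg (x := T.proj h y) (y := y)]) E
  refine ⟨max c 1, lt_max_of_lt_right one_pos, fun g hno hgE N p hp => ?_⟩
  obtain ⟨hp0, hpN, hstep⟩ := hp
  by_cases hg : g ∈ WPDBarrier.NF G (Set.range ax) x₀ (300 * D)
  · exact ⟨N, le_rfl, by rw [hpN]; exact ⟨hg, hgE⟩⟩
  obtain ⟨B, hB⟩ : ∃ B, 300 * D ≤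
      WPDBarrier.projDist (WPDBarrier.translate B (Set.range ax)) x₀ (g • x₀) := by
    by_contra! hcon
    exact hg hcon
  obtain ⟨t, htN, A, hAN, hAt, hclear⟩ := T.exists_time_forall_size_lt hDθ (N := N)
    (y := fun i => p i • x₀) (by simp [hp0])
    (fun i hi h => by
      have h1 := (hcontr h).dist_proj_le (hT h (p i • x₀)) (hT h (p (i + 1) • x₀))
      have h2 := hC _ _ (hstep i hi)
      linarith)
    ⟨B, by
      have := (hproj B (g • x₀)).2
      simp only [hpN]
      linarith⟩
  refine ⟨t, htN, fun h => ?_, ?_⟩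
  · have := (hproj h (p t • x₀)).2
    linarith [hclear h]
  · -- Otherwise the axis `A`, and with it the endpoint `g`, would violate the assumption on `g`.
    by_contra! hlt
    obtain ⟨k, hk, hAk⟩ := hc (p t) hlt A (by linarith)
    refine hno ⟨k, hk.trans (le_max_left _ _), ?_⟩
    have h1 := WPDBarrier.AxisSystem.size_le_of_near hAk (g • x₀)
    have h2 := (hproj k (g • x₀)).1
    simp only [hpN] at hAN
    linarith
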